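/- **Conventions.** Let $(\mathcal H,[\cdot,\cdot])$ be a complex Krein space with a canonical decomposition $\mathcal H=\mathcal H^-[\oplus]\mathcal H^+$, canonical projections $P^\pm$ and canonical symmetry $J=P^+-P^-$; thus $\mathcal H$ is a Hilbert space with respect to $\langle x,y\rangle=[x,Jy]$, with norm $\|x\|$, and closedness and density refer to this norm. Put $\mathcal H_\Gamma=\mathcal H\times\mathcal H$. A (linear) relation $T$ in $\mathcal H$ is a linear subset of $\mathcal H_\Gamma$. Its domain is $\mathcal D_T=\{x\mid \exists y\ (x,y)\in T\}$, and its multivalued part is $\operatorname{Ind}T=\{y\mid (0,y)\in T\}$. $T$ is an operator if $\operatorname{Ind}T=\{0\}$. The sum of relations $\hat+$ is the componentwise one, $S\,\hat+\,T=\{(x+u,y+v)\mid (x,y)\in S,\ (u,v)\in T\}$. The adjoint $T^c$ is the orthogonal complement of $T$ in $\mathcal H_\Gamma$ with respect to $$[(x_1,y_1),(x_2,y_2)]_\Gamma=-i\big([x_1,y_2]-[y_1,x_2]\big).$$ $T$ is symmetric if $[p,p]_\Gamma=0$ for all $p\in T$, and self-adjoint if $T=T^c$. Self-adjointness in the Hilbert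 space $(\mathcal H^-,-[\cdot,\cdot])$ is defined in the same way. A closed linear subset $M\subseteq\mathcal H$ is uniformly negative if there is $c>0$ with $[x,x]\le -c\|x\|^2$ for all $x\in M$. A relation $T$ is of class $(LP')$ if it is closed and symmetric, $\mathcal D_T$ contains a maximal uniformly negative subspace, and $\mathcal D_T+\operatorname{Ind}T$ is dense in $\mathcal H$. **Proposition 5.7.** Let $A$ be a closed symmetric relation in $\mathcal H=\mathcal H^-[\oplus]\mathcal H^+$, and let $L$ be a closed operator in $\mathcal H$ (for example the operator part of $A^c$) such that $$A^c=L\ \hat+\ (\{0\}\times\operatorname{Ind}A^c).$$ If $\mathcal H^-\subseteq\mathcal D_L$ and the operator $P^-L|_{\mathcal H^-}=\{(x,P^-z)\mid x\in\mathcal H^-,\ (x,z)\in L\}$ is self-adjoint in $(\mathcal H^-,-[\cdot,\cdot])$, then there is a closed symmetric relation $T$ with $A\subseteq T\subseteq A^c$ which is of class $(LP')$. -/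

import Mathlib

noncomputable section

namespace KreinRelation

/-! ### Linear relations in a linear space

A linear relation in `E` is a linear subset of `E × E`, i.e. a `Submodule ℂ (E × E)`. -/

section Relations

variable {E : Type*} [AddCommGroup E] [Module ℂ E]

/-- The domain of a relation. -/
def dom (T : Submodule ℂ (E × E)) : Submodule ℂ E := T.map (LinearMap.fst ℂ E E)

/-- The multivalued part (indefiniteness) `Ind T = {y | (0, y) ∈ T}`. -/
def ind (T : Submodule ℂ (E × E)) : Submodule ℂ E := T.comap (LinearMap.inr ℂ E E)

/-- A relation is (the graph of) an operator if its multivalued part is trivial. -/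
def IsOperator (T : Submodule ℂ (E × E)) : Prop := ind T = ⊥

/-- The form `[(x₁, y₁), (x₂, y₂)]_Γ = -i ([x₁, y₂] - [y₁, x₂])` on `E × E` attached to a
sesquilinear form `B = [·,·]` on `E` (conjugate-linear in the first variable). -/
def gammaForm (B : E →ₗ⋆[ℂ] E →ₗ[ℂ] ℂ) (p q : E × E) : ℂ :=
  -Complex.I * (B p.1 q.2 - B p.2 q.1)

/-- The adjoint of a relation with respect to `B`: its orthogonal complement in `E × E` with
respect to the form `[·,·]_Γ`. -/
def adj (B : E →ₗ⋆[ℂ] E →ₗ[ℂ] ℂ) (T : Submodule ℂ (E × E)) : Submodule ℂ (E × E) where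
  carrier := {p | ∀ q ∈ T, gammaForm B q p = 0}
  add_mem' := by
    intro a b ha hb q hq
    have h1 := ha q hq
    have h2 := hb q hq
    simp only [gammaForm, Prod.fst_add, Prod.snd_add, map_add] at h1 h2 ⊢
    linear_combination h1 + h2
  zero_mem' := by
    intro q _
    simp [gammaForm]
  smul_mem' := by
    intro c a ha q hq
    have h1 := ha q hq
    simp only [gammaForm, Prod.smul_fst, Prod.smul_snd, map_smul, smul_eq_mul] at h1 ⊢
    linear_combination c * h1

/-- A relation is symmetric if it is a neutral linear subset of `(E × E, [·,·]_Γ)`. -/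
def IsSymmetricRel (B : E →ₗ⋆[ℂ] E →ₗ[ℂ] ℂ) (T : Submodule ℂ (E × E)) : Prop :=
  ∀ p ∈ T, gammaForm B p p = 0

/-- A relation is self-adjoint if it coincides with its adjoint. -/
def IsSelfAdjointRel (B : E →ₗ⋆[ℂ] E →ₗ[ℂ] ℂ) (T : Submodule ℂ (E × E)) : Prop :=
  adj B T = T

end Relations

/-! ### Krein spaces with a given canonical decomposition

A Krein space together with a canonical decomposition `H = H⁻ [+] H⁺` is the same thing as a
Hilbert space `H`, with inner product `⟨x, y⟩ = [x, J y]`, and a canonical symmetry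
`J = P⁺ - P⁻`, i.e. a bounded self-adjoint operator with `J² = I`. -/

/-- A canonical symmetry `J = J* = J⁻¹` on a Hilbert space. -/
structure CanonicalSymmetry (H : Type*) [NormedAddCommGroup H] [InnerProductSpace ℂ H]
    [CompleteSpace H] where
  /-- the underlying operator -/
  J : H →L[ℂ] H
  isSelfAdjoint : IsSelfAdjoint J
  mul_self : J * J = 1

namespace CanonicalSymmetry

variable {H : Type*} [NormedAddCommGroup H] [InnerProductSpace ℂ H] [CompleteSpace H]
  (K : CanonicalSymmetry H)

/-- The indefinite inner product `[x, y] = ⟨x, J y⟩`, conjugate-linear in `x`. -/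
def form : H →ₗ⋆[ℂ] H →ₗ[ℂ] ℂ := (innerₛₗ ℂ).compl₂ (K.J : H →ₗ[ℂ] H)

/-- The canonical projection `P⁻ = (I - J) / 2`. -/
def Pneg : H →L[ℂ] H := (2⁻¹ : ℂ) • (1 - K.J)

/-- The negative component `H⁻` of the canonical decomposition, the eigenspace `J x = -x`. -/
def neg : Submodule ℂ H := LinearMap.ker ((K.J : H →ₗ[ℂ] H) + LinearMap.id)

/-- The Hilbert space inner product `-[·,·]` of `H⁻`. -/
def negForm : K.neg →ₗ⋆[ℂ] K.neg →ₗ[ℂ] ℂ :=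
  -((K.form.comp K.neg.subtype).compl₂ K.neg.subtype)

theorem Pneg_mem (x : H) : K.Pneg x ∈ K.neg := by
  have h : K.J (K.J x) = x := DFunLike.congr_fun K.mul_self x
  simp [neg, Pneg, h]

/-- The canonical projection `P⁻`, regarded as a map onto `H⁻`. -/
def PnegTo : H →ₗ[ℂ] K.neg := (K.Pneg : H →ₗ[ℂ] H).codRestrict K.neg K.Pneg_mem

/-- The relation `P⁻ T|H⁻` in `H⁻`: all pairs `(x, P⁻ z)` with `x ∈ H⁻` and `(x, z) ∈ T`. -/
def negCompression (T : Submodule ℂ (H × H)) : Submodule ℂ (K.neg × K.neg) :=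
  (T.comap (K.neg.subtype.prodMap LinearMap.id)).map (LinearMap.id.prodMap K.PnegTo)

/-- A uniformly negative subspace: closed, with `[x, x] ≤ -c ‖x‖²` for some `c > 0`. -/
def IsUniformlyNegative (M : Submodule ℂ H) : Prop :=
  IsClosed (M : Set H) ∧ ∃ c : ℝ, 0 < c ∧ ∀ x ∈ M, (K.form x x).re ≤ -c * ‖x‖ ^ 2

/-- Property (L): the domain contains a maximal uniformly negative subspace. -/
def PropL (T : Submodule ℂ (H × H)) : Prop :=
  ∃ M : Submodule ℂ H, Maximal K.IsUniformlyNegative M ∧ M ≤ dom T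

/-- Property (P'): `D_T + Ind T` is dense. -/
def PropP' (T : Submodule ℂ (H × H)) : Prop :=
  Dense ((dom T ⊔ ind T : Submodule ℂ H) : Set H)

/-- The set `Sym(A)` of closed symmetric canonical extensions `A ⊆ T ⊆ A^c`. -/
def Sym (A : Submodule ℂ (H × H)) : Set (Submodule ℂ (H × H)) :=
  {T | IsClosed (T : Set (H × H)) ∧ IsSymmetricRel K.form T ∧ A ≤ T ∧ T ≤ adj K.form A}

/-- The class (LP'): closed symmetric relations with the properties (L) and (P'). -/
structure IsLP' (T : Submodule ℂ (H × H)) : Prop where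
  isClosed : IsClosed (T : Set (H × H))
  isSymmetric : IsSymmetricRel K.form T
  propL : K.PropL T
  propP' : PropP' T

end CanonicalSymmetry

end KreinRelation

end

namespace KreinRelation

namespace CanonicalSymmetry

/-! Let `S` be the part of `L` over `H⁻`. For first components in `H⁻` the form ignores `P⁻`, so
symmetry of the compression makes `S` symmetric (`negRestrict_le_adj`). As `S` lies in `A^c`, `A ⊔
S` is symmetric too, and its domain `D` contains `H⁻`. Adjoining `{0} × D^[⊥]` keeps symmetry, and
the closure of the result is `T`. This multivalued part is large enough to force density
(`propP'_of_companion_le`). -/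

theorem re_inner_self {H : Type*} [NormedAddCommGroup H] [InnerProductSpace ℂ H] (x : H) :
    (inner ℂ x x).re = ‖x‖ ^ 2 :=
  inner_self_eq_norm_sq (𝕜 := ℂ) x

variable {H : Type*} [NormedAddCommGroup H] [InnerProductSpace ℂ H] [CompleteSpace H]
  (K : CanonicalSymmetry H)

theorem form_apply (x y : H) : K.form x y = inner ℂ x (K.J y) := rfl

theorem J_J (x : H) : K.J (K.J x) = x := DFunLike.congr_fun K.mul_self x

theorem inner_J_left (x y : H) : inner ℂ (K.J x) y = inner ℂ x (K.J y) :=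
  K.isSelfAdjoint.isSymmetric x y

theorem conj_form (x y : H) : (starRingEnd ℂ) (K.form x y) = K.form y x := by
  rw [form_apply, form_apply, inner_conj_symm, inner_J_left]

theorem mem_neg {x : H} : x ∈ K.neg ↔ K.J x = -x := by
  simp [neg, eq_neg_iff_add_eq_zero]

theorem form_Pneg_right {x : H} (hx : x ∈ K.neg) (y : H) :
    K.form x (K.Pneg y) = K.form x y := by
  have h : inner ℂ x y = -inner ℂ x (K.J y) := by
    rw [← inner_J_left, K.mem_neg.1 hx, inner_neg_left, neg_neg]
  simp only [form_apply, Pneg, smul_apply, sub_apply,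
    one_apply_eq_self, map_smul, map_sub, J_J, h]
  ring

theorem form_Pneg_left {y : H} (hy : y ∈ K.neg) (x : H) :
    K.form (K.Pneg x) y = K.form x y := by
  rw [← K.conj_form y, K.form_Pneg_right hy, K.conj_form]

theorem conj_gammaForm (p q : H × H) :
    (starRingEnd ℂ) (gammaForm K.form p q) = gammaForm K.form q p := by
  simp only [gammaForm, map_mul, map_neg, map_sub, Complex.conj_I, conj_form]
  ring

theorem le_adj_comm {S T : Submodule ℂ (H × H)} (h : S ≤ adj K.form T) :
    T ≤ adj K.form S := by
  intro p hp q hq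
  rw [← K.conj_gammaForm, h hq p hp, map_zero]

theorem isClosed_adj (T : Submodule ℂ (H × H)) :
    IsClosed (adj K.form T : Set (H × H)) := by
  have h : (adj K.form T : Set (H × H)) = ⋂ q ∈ T, {p | gammaForm K.form q p = 0} := by
    ext p
    simp [adj]
  rw [h]
  refine isClosed_biInter fun q _ => ?_
  simp only [gammaForm, form_apply]
  exact isClosed_eq (by fun_prop) continuous_const

/-- Adjoints are closed, so the closure may be taken in one argument of the form, then, after
swapping roles, in the other. -/
theorem topologicalClosure_le_adj {T : Submodule ℂ (H × H)} (h : T ≤ adj K.form T) :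
    T.topologicalClosure ≤ adj K.form T.topologicalClosure :=
  T.topologicalClosure_minimal
    (K.le_adj_comm (T.topologicalClosure_minimal h (K.isClosed_adj T))) (K.isClosed_adj _)

/-- Polarization: a neutral linear relation is contained in its adjoint. -/
theorem le_adj_of_isSymmetricRel {T : Submodule ℂ (H × H)} (h : IsSymmetricRel K.form T) :
    T ≤ adj K.form T := by
  intro p hp q hq
  have hpp := h p hp
  have hqq := h q hq
  have h1 := h (q + p) (T.add_mem hq hp)
  have h2 := h (q + Complex.I • p) (T.add_mem hq (T.smul_mem _ hp))
  simp only [gammaForm, Prod.fst_add, Prod.snd_add, Prod.smul_fst, Prod.smul_snd, map_add,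
    map_smul, LinearMap.map_smulₛₗ, LinearMap.add_apply, LinearMap.smul_apply, smul_eq_mul,
    Complex.conj_I] at hpp hqq h1 h2 ⊢
  -- The first term is the symmetric half of the form at `(q, p)`, the second the antisymmetric
  -- half; the third only uses `I ^ 2 = -1`.
  linear_combination (1 / 2 : ℂ) * (h1 - hqq - hpp)
    - (Complex.I / 2) * (h2 - hqq + Complex.I ^ 2 * hpp)
    + (1 / 2 : ℂ) * (-Complex.I * (K.form q.1 p.2 - K.form q.2 p.1)
      + Complex.I * (K.form p.1 q.2 - K.form p.2 q.1)) * Complex.I_sq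

theorem sup_le_adj_sup {S T : Submodule ℂ (H × H)} (hS : S ≤ adj K.form S)
    (hT : T ≤ adj K.form T) (hTS : T ≤ adj K.form S) :
    S ⊔ T ≤ adj K.form (S ⊔ T) := by
  refine sup_le (K.le_adj_comm (sup_le hS hTS)) (K.le_adj_comm (sup_le ?_ hT))
  exact K.le_adj_comm hTS

/-- The orthogonal companion of a subspace with respect to the Krein space form. -/
def companion (M : Submodule ℂ H) : Submodule ℂ H where
  carrier := {y | ∀ x ∈ M, K.form x y = 0}
  add_mem' := by
    intro a b ha hb x hx
    rw [map_add, ha x hx, hb x hx, add_zero]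
  zero_mem' := fun x _ => map_zero _
  smul_mem' := by
    intro c a ha x hx
    rw [map_smul, ha x hx, smul_zero]

/-- `Ind T^c` contains every subspace orthogonal to the domain of `T`. -/
theorem bot_prod_companion_le_adj {T : Submodule ℂ (H × H)} {M : Submodule ℂ H}
    (h : dom T ≤ M) : (⊥ : Submodule ℂ H).prod (K.companion M) ≤ adj K.form T := by
  rintro ⟨x, y⟩ ⟨hx, hy⟩ q hq
  obtain rfl : x = 0 := hx
  have hq1 : K.form q.1 y = 0 := hy q.1 (h ⟨q, hq, rfl⟩)
  simp [gammaForm, hq1]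

theorem isUniformlyNegative_neg : K.IsUniformlyNegative K.neg := by
  refine ⟨?_, 1, one_pos, fun x hx => ?_⟩
  · have h : (K.neg : Set H) = {x | K.J x = -x} := Set.ext fun x => K.mem_neg
    rw [h]
    exact isClosed_eq K.J.continuous continuous_neg
  · rw [form_apply, K.mem_neg.1 hx, inner_neg_right, Complex.neg_re, re_inner_self, neg_one_mul]

theorem J_sub_Pneg (x : H) : K.J (x - K.Pneg x) = x - K.Pneg x := by
  simp only [Pneg, smul_apply, sub_apply,
    one_apply_eq_self, map_smul, map_sub, J_J]
  module

/-- A larger uniformly negative subspace would also contain `x - P⁻x`, which `J` fixes, so its form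
is both `≥ 0` and `≤ 0`. -/
theorem maximal_neg : Maximal K.IsUniformlyNegative K.neg := by
  refine ⟨K.isUniformlyNegative_neg, fun M hM hle x hx => ?_⟩
  obtain ⟨-, c, hc, hneg⟩ := hM
  have h := hneg _ (M.sub_mem hx (hle (K.Pneg_mem x)))
  rw [form_apply, J_sub_Pneg, re_inner_self] at h
  have h0 : ‖x - K.Pneg x‖ ^ 2 = 0 := by
    have := sq_nonneg ‖x - K.Pneg x‖
    nlinarith
  have h1 : x = K.Pneg x := by
    rw [← sub_eq_zero, ← norm_eq_zero]
    exact pow_eq_zero_iff two_ne_zero |>.1 h0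
  rw [h1]
  exact K.Pneg_mem x

/-- The part of a relation with first components in `H⁻`. -/
def negRestrict (L : Submodule ℂ (H × H)) : Submodule ℂ (H × H) :=
  L ⊓ K.neg.comap (LinearMap.fst ℂ H H)

theorem dom_negRestrict_le (L : Submodule ℂ (H × H)) : dom (K.negRestrict L) ≤ K.neg := by
  rintro _ ⟨p, hp, rfl⟩
  exact hp.2

theorem negRestrict_le_adj {L : Submodule ℂ (H × H)}
    (h : K.negCompression L ≤ adj K.negForm (K.negCompression L)) :
    K.negRestrict L ≤ adj K.form (K.negRestrict L) := by
  have hmem : ∀ p (hp : p ∈ K.negRestrict L),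
      ((⟨p.1, hp.2⟩, K.PnegTo p.2) : K.neg × K.neg) ∈ K.negCompression L :=
    fun p hp => ⟨(⟨p.1, hp.2⟩, p.2), hp.1, rfl⟩
  intro p hp q hq
  have h0 : gammaForm K.negForm _ _ = 0 := h (hmem p hp) _ (hmem q hq)
  have h1 : -Complex.I * (-K.form q.1 (K.Pneg p.2) - -K.form (K.Pneg q.2) p.1) = 0 := h0
  rw [K.form_Pneg_right (x := q.1) hq.2, K.form_Pneg_left (y := p.1) hp.2] at h1
  simp only [gammaForm]
  linear_combination -h1

/-- If `D_T` contains `H⁻` and `{0} × D^{[⊥]} ⊆ T` for some `D ⊆ D_T`, then `T` has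
property (P'). -/
theorem propP'_of_companion_le {T : Submodule ℂ (H × H)} {D : Submodule ℂ H}
    (hneg : K.neg ≤ dom T) (hD : D ≤ dom T) (hT : K.companion D ≤ ind T) :
    PropP' T := by
  unfold PropP'
  rw [Submodule.dense_iff_topologicalClosure_eq_top,
    Submodule.topologicalClosure_eq_top_iff, Submodule.eq_bot_iff]
  intro w hw
  rw [Submodule.mem_orthogonal] at hw
  -- Since `J² = 1`, Hilbert orthogonality of `w` to `D` is Krein orthogonality of `J w` to `D`.
  -- Hence `w` is orthogonal to `J w` and to `w - J w ∈ H⁻`, so to itself.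
  have hJ : K.J w ∈ K.companion D := by
    intro x hx
    rw [form_apply, J_J]
    exact hw x (Submodule.mem_sup_left (hD hx))
  have h1 : inner ℂ (K.J w) w = 0 := hw _ (Submodule.mem_sup_right (hT hJ))
  have h2 : inner ℂ (w - K.J w) w = 0 := by
    refine hw _ (Submodule.mem_sup_left (hneg ?_))
    rw [mem_neg, map_sub, J_J, neg_sub]
  rw [inner_sub_left, h1, sub_zero] at h2
  exact inner_self_eq_zero.1 h2

end CanonicalSymmetry

end KreinRelation

open KreinRelation in
theorem proposition5p7 {H : Type*} [NormedAddCommGroup H] [InnerProductSpace ℂ H]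
    [CompleteSpace H] (K : KreinRelation.CanonicalSymmetry H)
    (A : Submodule ℂ (H × H)) (hA_closed : IsClosed (A : Set (H × H)))
    (hA_symm : KreinRelation.IsSymmetricRel K.form A)
    (L : Submodule ℂ (H × H)) (hL_closed : IsClosed (L : Set (H × H)))
    (hL_op : KreinRelation.IsOperator L)
    (hAL : KreinRelation.adj K.form A =
      L ⊔ (⊥ : Submodule ℂ H).prod (KreinRelation.ind (KreinRelation.adj K.form A)))
    (hL_dom : K.neg ≤ KreinRelation.dom L)
    (hL_sa : KreinRelation.IsSelfAdjointRel K.negForm (K.negCompression L)) :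
    ∃ T ∈ K.Sym A, K.IsLP' T := by
  have hLA : L ≤ adj K.form A := hAL ▸ le_sup_left
  have hA : A ≤ adj K.form A := K.le_adj_of_isSymmetricRel hA_symm
  set S := K.negRestrict L
  have hSA : S ≤ adj K.form A := inf_le_left.trans hLA
  have hAS : A ⊔ S ≤ adj K.form (A ⊔ S) :=
    K.sup_le_adj_sup hA (K.negRestrict_le_adj hL_sa.ge) hSA
  -- The companion is taken of the domain before closure; density needs no more.
  set N := (⊥ : Submodule ℂ H).prod (K.companion (dom (A ⊔ S)))
  have hNN : N ≤ adj K.form N := by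
    refine K.bot_prod_companion_le_adj ?_
    rintro _ ⟨p, hp, rfl⟩
    obtain h0 : p.1 = 0 := hp.1
    simp [h0]
  set T := (A ⊔ S ⊔ N).topologicalClosure
  have hle : A ⊔ S ⊔ N ≤ T := Submodule.le_topologicalClosure _
  have hsymm : T ≤ adj K.form T :=
    K.topologicalClosure_le_adj (K.sup_le_adj_sup hAS hNN (K.bot_prod_companion_le_adj le_rfl))
  have hclosed : IsClosed (T : Set (H × H)) := Submodule.isClosed_topologicalClosure _
  have hneutral : IsSymmetricRel K.form T := fun p hp => hsymm hp p hp
  have hAT : A ≤ T := (le_sup_left.trans le_sup_left).trans hle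
  have hdom : dom (A ⊔ S) ≤ dom T := Submodule.map_mono (le_sup_left.trans hle)
  have hneg : K.neg ≤ dom T := by
    refine le_trans ?_ hdom
    intro x hx
    obtain ⟨p, hp, rfl⟩ := hL_dom hx
    exact ⟨p, Submodule.mem_sup_right ⟨hp, hx⟩, rfl⟩
  have hind : K.companion (dom (A ⊔ S)) ≤ ind T := fun y hy =>
    hle (Submodule.mem_sup_right ⟨Submodule.zero_mem _, hy⟩)
  exact ⟨T, ⟨hclosed, hneutral, hAT, K.le_adj_comm (hAT.trans hsymm)⟩,
    hclosed, hneutral, ⟨K.neg, K.maximal_neg, hneg⟩, K.propP'_of_companion_le hneg hdom hind⟩
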